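/- **Weighted Skew Two Families.** Let $(A_1,B_1),\dots,(A_m,B_m)$ be pairs of finite non-empty sets, and write $a_i=|A_i|$ and $b_i=|B_i|$ for $1\le i\le m$. Suppose that (i) $A_i\cap B_i=\emptyset$ for $1\le i\le m$, (ii) $A_i\cap B_j\neq\emptyset$ for $1\le i<j\le m$, and (iii) $a_1\le a_2\le\dots\le a_m$ and $b_1\ge b_2\ge\dots\ge b_m$. Then $$\sum_{i=1}^m \frac{1}{\binom{a_i+b_i}{a_i}}\le 1.$$ -/

import Mathlib

open MvPolynomial

/-! Attach to each ground element a generic linear form over a field of characteristic two, so that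
its square vanishes modulo the squares of the variables, and let `P D` be the product of the forms
over `D`. Then `P (A i) * P (B j)` vanishes modulo squares for `i < j`, while `P (A i) * P (B i)`
has nonzero coefficient at every squarefree monomial of its degree.

Carry along a space `U` killed by all later `P (B j)`, and measure its density: its rank in degree
`a` on `a + b` variables, divided by `(a + b).choose a`. Adjoining `P (A i)` raises the rank by one,
hence the density by the `i`-th summand (`HasDensity.add_pair`). Passing to the next sizes, where
`a` grows and `b` shrinks, keeps the density bound (`HasDensity.change`), by local LYM counts on
leading monomials (`exists_erase_sqfreeRank`, `sqfreeRank_insert`). A density is at most one. -/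

/-! ### Dimension and leading positions -/

/-- Leading positions of a space of functions, for the order given by a weight. -/
def leadingPositions {K T : Type*} [Field K] (w : T → ℕ) (W : Submodule K (T → K)) : Set T :=
  {t | ∃ u ∈ W, u t ≠ 0 ∧ ∀ s, w s < w t → u s = 0}

/-- Triangularity: at the lightest position used by a linear relation, only one term survives. -/
theorem card_le_finrank_of_subset_leadingPositions {K T : Type*} [Field K] [Finite T]
    {w : T → ℕ} (hw : Function.Injective w) (W : Submodule K (T → K))
    (L : Finset T) (hL : ∀ t ∈ L, t ∈ leadingPositions w W) :
    L.card ≤ Module.finrank K W := by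
  classical
  choose! u huW hut hus using hL
  have hli : LinearIndependent K (fun t : L => (⟨u t, huW t t.2⟩ : W)) := by
    rw [Fintype.linearIndependent_iff]
    intro g hg
    by_contra! hne
    obtain ⟨i, hi⟩ := hne
    obtain ⟨t, ht, hmin⟩ := Finset.exists_min_image
      (Finset.univ.filter fun t : L => g t ≠ 0) (fun t => w t) ⟨i, by simpa using hi⟩
    simp only [Finset.mem_filter, Finset.mem_univ, true_and] at ht hmin
    have h0 := congrFun (congrArg Subtype.val hg) (t : T)
    simp only [Submodule.coe_sum, Submodule.coe_smul, Finset.sum_apply, Pi.smul_apply,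
      smul_eq_mul, ZeroMemClass.coe_zero, Pi.zero_apply] at h0
    rw [Finset.sum_eq_single t] at h0
    · exact (mul_ne_zero ht (hut t t.2)) h0
    · intro s _ hst
      by_cases hs : g s = 0
      · simp [hs]
      · have hlt : w t < w s := lt_of_le_of_ne (hmin s hs)
          fun h => hst (Subtype.ext (hw h).symm)
        rw [hus s s.2 t hlt, mul_zero]
    · simp
  simpa using hli.fintype_card_le_finrank

theorem finrank_le_card_leadingPositions {K T : Type*} [Field K] [Finite T]
    (w : T → ℕ) (W : Submodule K (T → K))
    (L : Finset T) (hL : ∀ t ∈ leadingPositions w W, t ∈ L) :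
    Module.finrank K W ≤ L.card := by
  classical
  let φ : W →ₗ[K] (L → K) := (LinearMap.funLeft K K (Subtype.val : L → T)).comp W.subtype
  have hφ : Function.Injective φ := by
    rw [← LinearMap.ker_eq_bot, LinearMap.ker_eq_bot']
    rintro ⟨u, hu⟩ h
    by_contra hne
    have hne' : ∃ t, u t ≠ 0 := by
      by_contra! h0
      exact hne (Subtype.ext (funext h0))
    have := Fintype.ofFinite T
    obtain ⟨i, hi⟩ := hne'
    obtain ⟨t, ht, hmin⟩ := Finset.exists_min_image
      (Finset.univ.filter fun t : T => u t ≠ 0) w ⟨i, by simpa using hi⟩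
    simp only [Finset.mem_filter, Finset.mem_univ, true_and] at ht hmin
    have hmem : t ∈ L := hL t ⟨u, hu, ht, fun s hs => by
      by_contra hne
      exact absurd (hmin s hne) (not_le.2 hs)⟩
    exact ht (congrFun h ⟨t, hmem⟩)
  simpa using LinearMap.finrank_le_finrank_of_injective hφ

/-! ### Squarefree coefficients modulo squares -/

/-- The exponent vector of the squarefree monomial with support `S`. -/
noncomputable def sqfreeExp {ι : Type*} (S : Finset ι) : ι →₀ ℕ :=
  ∑ c ∈ S, Finsupp.single c 1

theorem sqfreeExp_apply {ι : Type*} [DecidableEq ι] (S : Finset ι) (c : ι) :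
    sqfreeExp S c = if c ∈ S then 1 else 0 := by
  simp [sqfreeExp, Finsupp.finsetSum_apply, Finsupp.single_apply]

theorem degree_sqfreeExp {ι : Type*} (S : Finset ι) : (sqfreeExp S).degree = S.card := by
  simp [sqfreeExp, map_sum]

theorem exists_eq_sqfreeExp_of_le {ι : Type*} {S : Finset ι} {d : ι →₀ ℕ}
    (h : d ≤ sqfreeExp S) : ∃ T ⊆ S, d = sqfreeExp T := by
  classical
  refine ⟨d.support, fun c hc => ?_, ?_⟩
  · by_contra hcS
    have := h c
    rw [sqfreeExp_apply, if_neg hcS] at this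
    exact (Finsupp.mem_support_iff.1 hc) (by omega)
  · ext c
    have := h c
    rw [sqfreeExp_apply] at this ⊢
    by_cases hc : c ∈ d.support
    · have h1 := Finsupp.mem_support_iff.1 hc
      rw [if_pos hc]; split_ifs at this <;> omega
    · rw [if_neg hc]; exact Finsupp.notMem_support_iff.1 hc

theorem coeff_sqfreeExp_X_mul {ι K : Type*} [DecidableEq ι] [CommSemiring K] (c : ι)
    (S : Finset ι) (p : MvPolynomial ι K) :
    coeff (sqfreeExp S) (X c * p) = if c ∈ S then coeff (sqfreeExp (S.erase c)) p else 0 := by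
  rw [coeff_X_mul']
  have h : c ∈ (sqfreeExp S).support ↔ c ∈ S := by
    rw [Finsupp.mem_support_iff, sqfreeExp_apply]; simp
  simp only [h]
  split_ifs with hc
  · congr 1
    have : sqfreeExp S = sqfreeExp (S.erase c) + Finsupp.single c 1 := by
      rw [sqfreeExp, sqfreeExp, Finset.sum_erase_add _ _ hc]
    rw [this, add_tsub_cancel_right]
  · rfl

/-- The ideal generated by the squares of the variables. -/
noncomputable def squareIdeal (ι K : Type*) [CommSemiring K] : Ideal (MvPolynomial ι K) :=
  Ideal.span (Set.range fun c => X c ^ 2)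

theorem coeff_sqfreeExp_of_mem_squareIdeal {ι K : Type*} [CommSemiring K]
    {p : MvPolynomial ι K} (hp : p ∈ squareIdeal ι K) (S : Finset ι) :
    coeff (sqfreeExp S) p = 0 := by
  classical
  have : ∀ q, coeff (sqfreeExp S) (q * p) = 0 := by
    refine Submodule.span_induction ?_ (by simp) ?_ ?_ hp
    · rintro _ ⟨c, rfl⟩ q
      simp only [X_pow_eq_monomial]
      rw [coeff_mul_monomial', if_neg]
      intro h
      have := h c
      rw [sqfreeExp_apply] at this
      simp only [Finsupp.single_eq_same] at this
      split_ifs at this <;> omega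
    · intro x y _ _ hx hy q
      rw [mul_add, coeff_add, hx, hy, add_zero]
    · intro r x _ hx q
      rw [smul_eq_mul, ← mul_assoc, hx]
  simpa using this 1

/-! ### Squarefree rank under deletion and addition of a variable -/

/-- Reading off the coefficients at the squarefree monomials of degree `a` in the variables `C`. -/
noncomputable def sqfreeCoeffs {ι : Type*} (K : Type*) [CommSemiring K] (a : ℕ) (C : Finset ι) :
    MvPolynomial ι K →ₗ[K] ({S // S ∈ C.powersetCard a} → K) :=
  LinearMap.pi fun S => lcoeff K (sqfreeExp S.1)

theorem sqfreeCoeffs_apply {ι K : Type*} [CommSemiring K] (a : ℕ) (C : Finset ι)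
    (p : MvPolynomial ι K) (S : {S // S ∈ C.powersetCard a}) :
    sqfreeCoeffs K a C p S = coeff (sqfreeExp S.1) p := rfl

noncomputable def sqfreeRank {ι K : Type*} [Field K] (U : Submodule K (MvPolynomial ι K)) (a : ℕ)
    (C : Finset ι) : ℕ :=
  Module.finrank K (U.map (sqfreeCoeffs K a C))

theorem sqfreeRank_le_choose {ι K : Type*} [Field K] (U : Submodule K (MvPolynomial ι K)) (a : ℕ)
    (C : Finset ι) : sqfreeRank U a C ≤ C.card.choose a := by
  refine (Submodule.finrank_le _).trans ?_
  simp

/-- `S` is the lowest squarefree monomial of degree `a` in the variables `C` of some `u ∈ U`. -/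
def IsLeading {ι K : Type*} [Field K] (g : ι → ℕ) (U : Submodule K (MvPolynomial ι K)) (a : ℕ)
    (C S : Finset ι) : Prop :=
  S ∈ C.powersetCard a ∧ ∃ u ∈ U, coeff (sqfreeExp S) u ≠ 0 ∧
    ∀ T ∈ C.powersetCard a, ∑ c ∈ T, 2 ^ g c < ∑ c ∈ S, 2 ^ g c → coeff (sqfreeExp T) u = 0

theorem sum_two_pow_injective {ι : Type*} {g : ι → ℕ} (hg : Function.Injective g) :
    Function.Injective fun S : Finset ι => ∑ c ∈ S, 2 ^ g c := by
  intro S T h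
  have := Finset.geomSum_injective (n := 2) le_rfl (a₁ := S.map ⟨g, hg⟩) (a₂ := T.map ⟨g, hg⟩)
    (by simpa using h)
  exact Finset.map_injective _ this

theorem mem_leadingPositions_map {ι K : Type*} [Field K] (g : ι → ℕ)
    (U : Submodule K (MvPolynomial ι K)) (a : ℕ) (C : Finset ι)
    (S : {S // S ∈ C.powersetCard a}) :
    S ∈ leadingPositions (fun S => ∑ c ∈ S.1, 2 ^ g c) (U.map (sqfreeCoeffs K a C)) ↔
      IsLeading g U a C S := by
  constructor
  · rintro ⟨_, ⟨u, hu, rfl⟩, h1, h2⟩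
    exact ⟨S.2, u, hu, h1, fun T hT h => h2 ⟨T, hT⟩ h⟩
  · rintro ⟨_, u, hu, h1, h2⟩
    exact ⟨_, ⟨u, hu, rfl⟩, h1, fun T h => h2 T.1 T.2 h⟩

theorem card_le_sqfreeRank {ι K : Type*} [Field K] {g : ι → ℕ} (hg : Function.Injective g)
    (U : Submodule K (MvPolynomial ι K)) (a : ℕ) (C : Finset ι) (L : Finset (Finset ι))
    (hL : ∀ S ∈ L, IsLeading g U a C S) : L.card ≤ sqfreeRank U a C := by
  classical
  have h := card_le_finrank_of_subset_leadingPositions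
    (w := fun S : {S // S ∈ C.powersetCard a} => ∑ c ∈ S.1, 2 ^ g c)
    ((sum_two_pow_injective hg).comp Subtype.val_injective) (U.map (sqfreeCoeffs K a C))
    (L.subtype (· ∈ C.powersetCard a))
    fun S hS => (mem_leadingPositions_map g U a C S).2 (hL _ (Finset.mem_subtype.1 hS))
  rwa [Finset.card_subtype, Finset.filter_true_of_mem fun S hS => (hL S hS).1] at h

theorem exists_card_eq_sqfreeRank {ι K : Type*} [Field K] {g : ι → ℕ} (hg : Function.Injective g)
    (U : Submodule K (MvPolynomial ι K)) (a : ℕ) (C : Finset ι) :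
    ∃ L : Finset (Finset ι), (∀ S ∈ L, IsLeading g U a C S) ∧ L.card = sqfreeRank U a C := by
  classical
  refine ⟨(C.powersetCard a).filter (IsLeading g U a C), by simp, le_antisymm
    (card_le_sqfreeRank hg U a C _ (by simp)) ?_⟩
  have h := finrank_le_card_leadingPositions
    (fun S : {S // S ∈ C.powersetCard a} => ∑ c ∈ S.1, 2 ^ g c) (U.map (sqfreeCoeffs K a C))
    (((C.powersetCard a).filter (IsLeading g U a C)).subtype (· ∈ C.powersetCard a))
    fun S hS => by
      rw [Finset.mem_subtype, Finset.mem_filter]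
      exact ⟨S.2, (mem_leadingPositions_map g U a C S).1 hS⟩
  rwa [Finset.card_subtype, Finset.filter_true_of_mem
    fun S hS => (Finset.mem_filter.1 hS).1] at h

theorem IsLeading.mono {ι K : Type*} [Field K] {g : ι → ℕ}
    {U : Submodule K (MvPolynomial ι K)} {a : ℕ} {C D S : Finset ι} (h : IsLeading g U a C S)
    (hD : D ⊆ C) (hS : S ⊆ D) : IsLeading g U a D S := by
  obtain ⟨hSC, u, hu, h1, h2⟩ := h
  exact ⟨Finset.mem_powersetCard.2 ⟨hS, (Finset.mem_powersetCard.1 hSC).2⟩, u, hu, h1,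
    fun T hT => h2 T (Finset.powersetCard_mono hD hT)⟩

/-- Each leading monomial misses `b + 1` variables of `C` and stays leading when one of them is
deleted; average over the deleted variable. -/
theorem exists_erase_sqfreeRank {ι K : Type*} [Field K] [DecidableEq ι] {g : ι → ℕ}
    (hg : Function.Injective g) (U : Submodule K (MvPolynomial ι K)) (a b : ℕ) (C : Finset ι)
    (hC : C.card = a + b + 1) :
    ∃ j ∈ C, (b + 1) * sqfreeRank U a C ≤ (a + b + 1) * sqfreeRank U a (C.erase j) := by
  obtain ⟨L, hL, hLc⟩ := exists_card_eq_sqfreeRank hg U a C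
  have key : (b + 1) * L.card ≤ ∑ j ∈ C, sqfreeRank U a (C.erase j) := by
    calc (b + 1) * L.card = ∑ S ∈ L, (C.filter fun j => j ∉ S).card := by
          rw [Finset.sum_congr rfl (g := fun _ => b + 1), Finset.sum_const, smul_eq_mul, mul_comm]
          intro S hS
          have h := Finset.mem_powersetCard.1 (hL S hS).1
          rw [Finset.filter_notMem_eq_sdiff, Finset.card_sdiff_of_subset h.1]
          omega
      _ = ∑ j ∈ C, (L.filter fun S => j ∉ S).card := by
          simp only [Finset.card_filter]
          exact Finset.sum_comm
      _ ≤ _ := by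
          refine Finset.sum_le_sum fun j _ => card_le_sqfreeRank hg _ _ _ _ fun S hS => ?_
          rw [Finset.mem_filter] at hS
          exact (hL S hS.1).mono (Finset.erase_subset _ _) (Finset.subset_erase.2
            ⟨(Finset.mem_powersetCard.1 (hL S hS.1).1).1, hS.2⟩)
  by_contra! hlt
  have hne : C.Nonempty := Finset.card_pos.1 (by omega)
  have h := Finset.sum_lt_sum_of_nonempty hne hlt
  rw [← Finset.mul_sum, Finset.sum_const, smul_eq_mul, hC, ← hLc] at h
  exact absurd (Nat.mul_le_mul_left (a + b + 1) key) (not_le.2 h)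

/-- The products of elements of `U` with linear forms. -/
noncomputable def mulLinear {ι K : Type*} [Field K] (U : Submodule K (MvPolynomial ι K)) :
    Submodule K (MvPolynomial ι K) :=
  ⨆ c, U.map (LinearMap.mulLeft K (X c))

theorem X_mul_mem_mulLinear {ι K : Type*} [Field K] {U : Submodule K (MvPolynomial ι K)}
    {u : MvPolynomial ι K} (hu : u ∈ U) (c : ι) : X c * u ∈ mulLinear U :=
  Submodule.mem_iSup_of_mem c ⟨u, hu, rfl⟩

theorem mul_mem_of_mem_mulLinear {ι K : Type*} [Field K] {U : Submodule K (MvPolynomial ι K)}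
    {I : Ideal (MvPolynomial ι K)} {f : MvPolynomial ι K} (h : ∀ u ∈ U, u * f ∈ I) :
    ∀ u ∈ mulLinear U, u * f ∈ I := by
  have : mulLinear U ≤ (I.restrictScalars K).comap (LinearMap.mulRight K f) := by
    refine iSup_le fun c => ?_
    rintro _ ⟨u, hu, rfl⟩
    have := I.mul_mem_left (X c) (h u hu)
    simpa [mul_assoc] using this
  exact fun u hu => this hu

/-- Multiplying by `X c` preserves weight comparisons. A competitor still containing `j` once `c` is
erased is heavier than `S`, since `2 ^ g j` exceeds the weight of any subset of `C`. -/
theorem IsLeading.insert {ι K : Type*} [Field K] [DecidableEq ι] {g : ι → ℕ}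
    (hg : Function.Injective g) {U : Submodule K (MvPolynomial ι K)} {a : ℕ} {C S : Finset ι}
    (h : IsLeading g U a C S) {j : ι} (hj : ∀ c ∈ C, g c < g j) {c : ι} (hc : c ∈ insert j C)
    (hcS : c ∉ S) : IsLeading g (mulLinear U) (a + 1) (insert j C) (insert c S) := by
  obtain ⟨hSC, u, hu, h1, h2⟩ := h
  rw [Finset.mem_powersetCard] at hSC
  refine ⟨?_, X c * u, X_mul_mem_mulLinear hu c, ?_, fun T hT hlt => ?_⟩
  · rw [Finset.mem_powersetCard, Finset.card_insert_of_notMem hcS, hSC.2]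
    exact ⟨Finset.insert_subset hc (hSC.1.trans (Finset.subset_insert _ _)), rfl⟩
  · rw [coeff_sqfreeExp_X_mul, if_pos (Finset.mem_insert_self _ _), Finset.erase_insert hcS]
    exact h1
  · rw [coeff_sqfreeExp_X_mul]
    split_ifs with hcT
    · rw [Finset.mem_powersetCard] at hT
      rw [Finset.sum_insert hcS, ← Finset.add_sum_erase _ _ hcT] at hlt
      have hlt' := lt_of_add_lt_add_left hlt
      refine h2 _ (Finset.mem_powersetCard.2 ⟨fun d hd => ?_, ?_⟩) hlt'
      · refine Finset.mem_of_mem_insert_of_ne (hT.1 (Finset.mem_of_mem_erase hd)) ?_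
        rintro rfl
        have hS := Nat.geomSum_lt (m := 2) (n := g d) (s := S.map ⟨g, hg⟩) le_rfl (by
          intro k hk
          obtain ⟨e, he, rfl⟩ := Finset.mem_map.1 hk
          exact hj e (hSC.1 he))
        rw [Finset.sum_map] at hS
        have := Finset.single_le_sum (f := fun c => 2 ^ g c) (fun _ _ => Nat.zero_le _) hd
        simp only [Function.Embedding.coeFn_mk] at hS this
        omega
      · rw [Finset.card_erase_of_mem hcT, hT.2, Nat.add_sub_cancel]
    · rfl

/-- The product space has leading monomials `insert j S`, one per `S ∈ L`, and the upper shadow of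
`L` in `C`, of size at least `L.card * b / (a + 1)` by double counting. -/
theorem sqfreeRank_insert {ι K : Type*} [Field K] [DecidableEq ι] {g : ι → ℕ}
    (hg : Function.Injective g) (U : Submodule K (MvPolynomial ι K)) (a b : ℕ) (C : Finset ι)
    (hC : C.card = a + b) {j : ι} (hj : ∀ c ∈ C, g c < g j) :
    (a + b + 1) * sqfreeRank U a C ≤ (a + 1) * sqfreeRank (mulLinear U) (a + 1) (insert j C) := by
  obtain ⟨L, hL, hLc⟩ := exists_card_eq_sqfreeRank hg U a C
  have hLS := fun S hS => Finset.mem_powersetCard.1 (hL S hS).1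
  have hjC : j ∉ C := fun h => lt_irrefl _ (hj j h)
  set M₁ := L.image (insert j) with hM₁
  set M₂ := L.biUnion fun S => (C \ S).image fun c => insert c S with hM₂
  have hjS : ∀ S ∈ L, j ∉ S := fun S hS h => hjC ((hLS S hS).1 h)
  have hM₂j : ∀ T ∈ M₂, j ∉ T := by
    intro T hT
    simp only [hM₂, Finset.mem_biUnion, Finset.mem_image, Finset.mem_sdiff] at hT
    obtain ⟨S, hS, c, ⟨hc, -⟩, rfl⟩ := hT
    rw [Finset.mem_insert]
    rintro (rfl | h)
    exacts [hjC hc, hjS S hS h]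
  have hcard₁ : M₁.card = L.card := by
    refine Finset.card_image_of_injOn fun S hS T hT h => ?_
    rw [← Finset.erase_insert (hjS S hS), ← Finset.erase_insert (hjS T hT)]
    exact congrArg (fun S => Finset.erase S j) h
  have hdisj : Disjoint M₁ M₂ := by
    rw [Finset.disjoint_left]
    intro T h1 h2
    obtain ⟨S, _, rfl⟩ := Finset.mem_image.1 h1
    exact hM₂j _ h2 (Finset.mem_insert_self _ _)
  have hcard₂ : L.card * b ≤ M₂.card * (a + 1) := by
    refine Finset.card_mul_le_card_mul (· ⊆ ·) (fun S hS => ?_) fun T hT => ?_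
    · calc b = (C \ S).card := by
            rw [Finset.card_sdiff_of_subset (hLS S hS).1, hC, (hLS S hS).2, Nat.add_sub_cancel_left]
        _ = ((C \ S).image fun c => insert c S).card := by
            refine (Finset.card_image_of_injOn fun c hc d hd h => ?_).symm
            have hmem : c ∈ insert d S := by
              rw [← (show insert c S = insert d S from h)]; exact Finset.mem_insert_self _ _
            exact (Finset.mem_insert.1 hmem).resolve_right (Finset.mem_sdiff.1 hc).2
        _ ≤ _ := by
            refine Finset.card_le_card fun T hT => ?_
            rw [Finset.mem_bipartiteAbove]
            refine ⟨Finset.mem_biUnion.2 ⟨S, hS, hT⟩, ?_⟩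
            obtain ⟨c, _, rfl⟩ := Finset.mem_image.1 hT
            exact Finset.subset_insert _ _
    · have hTc : T.card = a + 1 := by
        simp only [hM₂, Finset.mem_biUnion, Finset.mem_image, Finset.mem_sdiff] at hT
        obtain ⟨S, hS, c, ⟨-, hc⟩, rfl⟩ := hT
        rw [Finset.card_insert_of_notMem hc, (hLS S hS).2]
      calc _ ≤ (T.powersetCard a).card := by
            refine Finset.card_le_card fun S hS => ?_
            rw [Finset.mem_bipartiteBelow] at hS
            exact Finset.mem_powersetCard.2 ⟨hS.2, (hLS S hS.1).2⟩
        _ = a + 1 := by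
            rw [Finset.card_powersetCard, hTc, Nat.choose_succ_self_right]
  have hle : (M₁ ∪ M₂).card ≤ sqfreeRank (mulLinear U) (a + 1) (insert j C) := by
    refine card_le_sqfreeRank hg _ _ _ _ fun T hT => ?_
    rcases Finset.mem_union.1 hT with hT | hT
    · obtain ⟨S, hS, rfl⟩ := Finset.mem_image.1 hT
      exact (hL S hS).insert hg hj (Finset.mem_insert_self _ _) (hjS S hS)
    · simp only [hM₂, Finset.mem_biUnion, Finset.mem_image, Finset.mem_sdiff] at hT
      obtain ⟨S, hS, c, ⟨hc, hcS⟩, rfl⟩ := hT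
      exact (hL S hS).insert hg hj (Finset.mem_insert_of_mem hc) hcS
  rw [Finset.card_union_of_disjoint hdisj, hcard₁] at hle
  rw [← hLc]
  nlinarith

/-! ### Adjoining one polynomial -/

theorem coeff_sqfreeExp_mul_eq_zero {ι K : Type*} [CommSemiring K] {a b : ℕ} {C : Finset ι}
    (hC : C.card = a + b) {p h : MvPolynomial ι K} (hh : h.IsHomogeneous b)
    (hp : ∀ S ∈ C.powersetCard a, coeff (sqfreeExp S) p = 0) :
    coeff (sqfreeExp C) (p * h) = 0 := by
  classical
  rw [coeff_mul]
  refine Finset.sum_eq_zero fun x hx => ?_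
  rw [Finset.HasAntidiagonal.mem_antidiagonal] at hx
  obtain ⟨T, hT, hxT⟩ := exists_eq_sqfreeExp_of_le (d := x.1) (S := C) (hx ▸ le_self_add)
  by_cases hTa : T.card = a
  · rw [hxT, hp T (Finset.mem_powersetCard.2 ⟨hT, hTa⟩), zero_mul]
  · rw [hh.coeff_eq_zero, mul_zero]
    have := congrArg Finsupp.degree hx
    rw [map_add, hxT, degree_sqfreeExp, degree_sqfreeExp, hC] at this
    omega

/-- If `f` had the same degree-`a` coefficients on `C` as some `u ∈ U`, then `f * h` and `u * h`
would agree at `C`, where the latter vanishes. -/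
theorem sqfreeRank_sup_span_singleton {ι K : Type*} [Field K]
    (U : Submodule K (MvPolynomial ι K)) {a b : ℕ} {C : Finset ι}
    (hC : C.card = a + b) {f h : MvPolynomial ι K} (hh : h.IsHomogeneous b)
    (hU : ∀ u ∈ U, u * h ∈ squareIdeal ι K) (hf : coeff (sqfreeExp C) (f * h) ≠ 0) :
    sqfreeRank U a C + 1 ≤ sqfreeRank (U ⊔ Submodule.span K {f}) a C := by
  refine Submodule.finrank_lt_finrank_of_lt (lt_of_le_of_ne (Submodule.map_mono le_sup_left) ?_)
  intro heq
  have hmem : sqfreeCoeffs K a C f ∈ U.map (sqfreeCoeffs K a C) := by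
    rw [heq]
    exact ⟨f, Submodule.mem_sup_right (Submodule.mem_span_singleton_self f), rfl⟩
  obtain ⟨u, hu, huf⟩ := hmem
  refine hf ?_
  have h0 : coeff (sqfreeExp C) ((f - u) * h) = 0 := by
    refine coeff_sqfreeExp_mul_eq_zero hC hh fun S hS => ?_
    rw [coeff_sub, sub_eq_zero]
    exact (congrFun huf ⟨S, hS⟩).symm
  rw [sub_mul, coeff_sub, coeff_sqfreeExp_of_mem_squareIdeal (hU u hu), sub_zero] at h0
  exact h0

/-! ### Generic linear forms -/

/-- Linear forms in characteristic two that are in general position. -/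
theorem exists_generic_linear_forms.{u, v} (α : Type u) (ι : Type v) [Fintype ι] :
    ∃ (K : Type (max u v)) (_ : Field K) (l : α → MvPolynomial ι K),
      (∀ x, (l x).IsHomogeneous 1) ∧ (∀ x, l x ^ 2 ∈ squareIdeal ι K) ∧
      ∀ (D : Finset α) (C : Finset ι), D.card = C.card →
        coeff (sqfreeExp C) (∏ x ∈ D, l x) ≠ 0 := by
  classical
  let R := MvPolynomial (α × ι) (ZMod 2)
  let φ : R →+* FractionRing R := algebraMap R (FractionRing R)
  have hφ : Function.Injective φ := IsFractionRing.injective R (FractionRing R)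
  let lR : α → MvPolynomial ι R := fun x => ∑ c, C (X (x, c)) * X c
  have hhom : ∀ x, (lR x).IsHomogeneous 1 := fun x =>
    IsHomogeneous.sum _ _ _ fun c _ => by
      simpa using (isHomogeneous_C ι (X (x, c) : R)).mul (isHomogeneous_X R c)
  refine ⟨FractionRing R, inferInstance, fun x => map φ (lR x), fun x => (hhom x).map φ,
    fun x => ?_, fun D T hDT => ?_⟩
  -- Characteristic two removes the cross terms.
  · have : lR x ^ 2 = ∑ c, C (X (x, c)) ^ 2 * X c ^ 2 := by
      have : CharP (MvPolynomial ι R) 2 := inferInstance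
      rw [CharTwo.sum_sq]
      simp only [mul_pow]
    rw [← map_pow, this, map_sum]
    refine Ideal.sum_mem _ fun c _ => ?_
    rw [map_mul, map_pow _ (X c), map_X]
    exact Ideal.mul_mem_left _ _ (Ideal.subset_span ⟨c, rfl⟩)
  · rw [← map_prod, coeff_map]
    refine (map_ne_zero_iff φ hφ).2 fun h0 => ?_
    let e : D ≃ T := Finset.equivOfCardEq hDT
    -- Specialise the coefficients to the incidence matrix of the bijection `e`: each form becomes a
    -- single variable.
    let ψ : R →+* ZMod 2 :=
      eval fun y : α × ι => if h : y.1 ∈ D then (if (e ⟨y.1, h⟩ : ι) = y.2 then 1 else 0) else 0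
    have h1 : map ψ (∏ x ∈ D, lR x) = monomial (sqfreeExp T) 1 := by
      rw [map_prod, ← Finset.prod_coe_sort]
      have : ∀ x : D, map ψ (lR x) = X (e x : ι) := by
        intro x
        simp only [lR, map_sum, map_mul, map_C, map_X]
        rw [Finset.sum_eq_single (e x : ι)]
        · rw [show ψ (X (x.1, (e x : ι))) = 1 from (eval_X _).trans (by simp), C_1, one_mul]
        · intro c _ hc
          rw [show ψ (X (x.1, c)) = 0 from (eval_X _).trans (by simp [hc.symm]), C_0, zero_mul]
        · simp
      rw [Finset.prod_congr rfl fun x _ => this x, e.prod_comp (fun c : T => (X (c : ι))),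
        Finset.prod_coe_sort T (fun c => (X c : MvPolynomial ι (ZMod 2))), sqfreeExp,
        monomial_sum_one]
      rfl
    have h2 := congrArg (coeff (sqfreeExp T)) h1
    rw [coeff_map, h0, map_zero, coeff_monomial, if_pos rfl] at h2
    exact zero_ne_one h2

/-! ### Density and its transport -/

/-- A space annihilated by every `h ∈ F` whose degree-`a` part on `a + b` of the
variables has relative dimension at least `σ`. -/
def HasDensity {ι K : Type*} [Field K] (F : Set (MvPolynomial ι K)) (a b : ℕ) (σ : ℝ) : Prop :=
  ∃ (U : Submodule K (MvPolynomial ι K)) (C : Finset ι), C.card = a + b ∧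
    (∀ h ∈ F, ∀ u ∈ U, u * h ∈ squareIdeal ι K) ∧
    σ * ((a + b).choose a : ℝ) ≤ sqfreeRank U a C

theorem HasDensity.le_one {ι K : Type*} [Field K] {F : Set (MvPolynomial ι K)} {a b : ℕ} {σ : ℝ}
    (h : HasDensity F a b σ) : σ ≤ 1 := by
  obtain ⟨U, C, hC, -, hσ⟩ := h
  have h1 := sqfreeRank_le_choose U a C
  rw [hC] at h1
  have h2 : (0 : ℝ) < (a + b).choose a := by exact_mod_cast Nat.choose_pos le_self_add
  have h3 : (sqfreeRank U a C : ℝ) ≤ (a + b).choose a := by exact_mod_cast h1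
  nlinarith

theorem hasDensity_zero {K : Type*} [Field K] {N : ℕ} (F : Set (MvPolynomial (Fin N) K)) {a b : ℕ}
    (h : a + b ≤ N) : HasDensity F a b 0 := by
  obtain ⟨C, -, hC⟩ := Finset.exists_subset_card_eq (s := (Finset.univ : Finset (Fin N)))
    (n := a + b) (by simpa using h)
  exact ⟨⊥, C, hC, by simp, by simp⟩

theorem HasDensity.mono {ι K : Type*} [Field K] {F G : Set (MvPolynomial ι K)} {a b : ℕ} {σ : ℝ}
    (h : HasDensity F a b σ) (hG : G ⊆ F) : HasDensity G a b σ := by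
  obtain ⟨U, C, hC, hU, hσ⟩ := h
  exact ⟨U, C, hC, fun h hh => hU h (hG hh), hσ⟩

theorem HasDensity.of_right_succ {K : Type*} [Field K] {N : ℕ} {F : Set (MvPolynomial (Fin N) K)}
    {a b : ℕ} {σ : ℝ} (h : HasDensity F a (b + 1) σ) : HasDensity F a b σ := by
  obtain ⟨U, C, hC, hU, hσ⟩ := h
  obtain ⟨j, hj, hle⟩ := exists_erase_sqfreeRank (g := fun c : Fin N => (c : ℕ))
    Fin.val_injective U a b C hC
  refine ⟨U, C.erase j, by rw [Finset.card_erase_of_mem hj]; omega, hU, ?_⟩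
  have hch : ((a + b + 1).choose a : ℝ) * (b + 1) = (a + b + 1) * (a + b).choose a := by
    have := Nat.choose_mul_succ_eq (a + b) a
    rw [show a + b + 1 - a = b + 1 by omega] at this
    have := congrArg (Nat.cast : ℕ → ℝ) this
    push_cast at this
    linarith
  have hle' : ((b : ℝ) + 1) * sqfreeRank U a C ≤ (a + b + 1) * sqfreeRank U a (C.erase j) := by
    exact_mod_cast hle
  rw [← add_assoc] at hσ
  refine le_of_mul_le_mul_left (a := (a + b + 1 : ℝ)) ?_ (by positivity)
  calc (a + b + 1 : ℝ) * (σ * (a + b).choose a) = (b + 1) * (σ * (a + b + 1).choose a) := by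
        linear_combination (-σ) * hch
    _ ≤ (b + 1) * sqfreeRank U a C := by gcongr
    _ ≤ _ := hle'

theorem HasDensity.left_succ {K : Type*} [Field K] {N : ℕ} {F : Set (MvPolynomial (Fin N) K)}
    {a b : ℕ} {σ : ℝ} (h : HasDensity F a b σ) (hN : a + b < N) : HasDensity F (a + 1) b σ := by
  obtain ⟨U, C, hC, hU, hσ⟩ := h
  obtain ⟨j, hj⟩ : ∃ j, j ∉ C := by
    by_contra! hall
    have := Finset.card_le_card (fun c _ => hall c : (Finset.univ : Finset (Fin N)) ⊆ C)
    rw [Finset.card_fin] at this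
    omega
  -- The rank does not depend on the order, so `j` may be made the heaviest variable.
  let g : Fin N → ℕ := fun c => if c = j then N else c
  have hg : Function.Injective g := by
    intro c d hcd
    have := c.2
    have := d.2
    simp only [g] at hcd
    split_ifs at hcd with h1 h2 h2
    · rw [h1, h2]
    · omega
    · omega
    · exact Fin.ext hcd
  have hle := sqfreeRank_insert hg U a b C hC (j := j) fun c hc => by
    have hcj : c ≠ j := fun h => hj (h ▸ hc)
    simp [g, hcj]
  refine ⟨mulLinear U, insert j C, by rw [Finset.card_insert_of_notMem hj]; omega,
    fun h hh => mul_mem_of_mem_mulLinear (hU h hh), ?_⟩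
  have hch : ((a + b + 1).choose (a + 1) : ℝ) * (a + 1) = (a + b + 1) * (a + b).choose a := by
    exact_mod_cast (Nat.add_one_mul_choose_eq (a + b) a).symm
  have hle' : ((a : ℝ) + b + 1) * sqfreeRank U a C ≤
      (a + 1) * sqfreeRank (mulLinear U) (a + 1) (insert j C) := by exact_mod_cast hle
  rw [show a + 1 + b = a + b + 1 by ring]
  refine le_of_mul_le_mul_left (a := (a + 1 : ℝ)) ?_ (by positivity)
  calc (a + 1 : ℝ) * (σ * (a + b + 1).choose (a + 1)) = (a + b + 1) * (σ * (a + b).choose a) := by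
        linear_combination σ * hch
    _ ≤ (a + b + 1) * sqfreeRank U a C := by gcongr
    _ ≤ _ := hle'

theorem HasDensity.change {K : Type*} [Field K] {N : ℕ} {F : Set (MvPolynomial (Fin N) K)}
    {a a' b b' : ℕ} {σ : ℝ} (h : HasDensity F a b σ) (ha : a ≤ a') (hb : b' ≤ b)
    (hN : a' + b' ≤ N) : HasDensity F a' b' σ := by
  have h1 : HasDensity F a b' σ := by
    induction b, hb using Nat.le_induction with
    | base => exact h
    | succ b _ ih => exact ih h.of_right_succ
  clear h hb
  induction a', ha using Nat.le_induction with
  | base => exact h1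
  | succ a' _ ih => exact (ih (by omega)).left_succ (by omega)

theorem HasDensity.add_pair {ι K : Type*} [Field K] {F G : Set (MvPolynomial ι K)} {a b : ℕ}
    {σ : ℝ} (hd : HasDensity F a b σ) {f h : MvPolynomial ι K} (hh : h.IsHomogeneous b)
    (hhF : h ∈ F) (hG : G ⊆ F) (hfG : ∀ k ∈ G, f * k ∈ squareIdeal ι K)
    (hf : ∀ C : Finset ι, C.card = a + b → coeff (sqfreeExp C) (f * h) ≠ 0) :
    HasDensity G a b (σ + 1 / ((a + b).choose a : ℝ)) := by
  obtain ⟨U, C, hC, hU, hσ⟩ := hd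
  refine ⟨U ⊔ Submodule.span K {f}, C, hC, fun k hk u hu => ?_, ?_⟩
  · obtain ⟨v, hv, w, hw, rfl⟩ := Submodule.mem_sup.1 hu
    obtain ⟨r, rfl⟩ := Submodule.mem_span_singleton.1 hw
    rw [add_mul, smul_mul_assoc, smul_eq_C_mul]
    exact add_mem (hU k (hG hk) v hv) (Ideal.mul_mem_left _ _ (hfG k hk))
  · have h1 := sqfreeRank_sup_span_singleton U hC hh (hU h hhF) (hf C hC)
    have h2 : (0 : ℝ) < (a + b).choose a := by exact_mod_cast Nat.choose_pos le_self_add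
    rw [add_mul, one_div_mul_cancel h2.ne']
    have h3 : (sqfreeRank U a C : ℝ) + 1 ≤ sqfreeRank (U ⊔ Submodule.span K {f}) a C := by
      exact_mod_cast h1
    linarith

/-! ### Induction over the pairs -/

theorem corollary3p6 {α : Type*} [DecidableEq α] (m : ℕ) (A B : Fin m → Finset α)
    (hA : ∀ i, (A i).Nonempty) (hB : ∀ i, (B i).Nonempty)
    (hdisj : ∀ i, A i ∩ B i = ∅)
    (hskew : ∀ i j, i < j → A i ∩ B j ≠ ∅)
    (hAmono : ∀ i j, i ≤ j → (A i).card ≤ (A j).card)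
    (hBanti : ∀ i j, i ≤ j → (B j).card ≤ (B i).card) :
    ∑ i, (1 : ℝ) / (((A i).card + (B i).card).choose (A i).card : ℝ) ≤ 1 := by
  -- Any number of variables bounding every `a_i + b_i` would do.
  set N := ∑ i, ((A i).card + (B i).card)
  have hN : ∀ i, (A i).card + (B i).card ≤ N := fun i =>
    Finset.single_le_sum (f := fun i => (A i).card + (B i).card) (fun _ _ => Nat.zero_le _)
      (Finset.mem_univ i)
  obtain ⟨K, _, l, hhom, hsq, hgen⟩ := exists_generic_linear_forms α (Fin N)
  let P : Finset α → MvPolynomial (Fin N) K := fun D => ∏ x ∈ D, l x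
  have hPhom : ∀ D, (P D).IsHomogeneous D.card := fun D => by
    simpa using IsHomogeneous.prod D l (fun _ => 1) fun x _ => hhom x
  have hPsq : ∀ D E, D ∩ E ≠ ∅ → P D * P E ∈ squareIdeal (Fin N) K := by
    intro D E h
    obtain ⟨x, hx⟩ := Finset.nonempty_iff_ne_empty.2 h
    rw [Finset.mem_inter] at hx
    refine Ideal.mem_of_dvd _ ?_ (hsq x)
    rw [sq]
    exact mul_dvd_mul (Finset.dvd_prod_of_mem _ hx.1) (Finset.dvd_prod_of_mem _ hx.2)
  have hadd : ∀ i σ, HasDensity {p | ∃ j, i ≤ j ∧ p = P (B j)} (A i).card (B i).card σ →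
      HasDensity {p | ∃ j, i < j ∧ p = P (B j)} (A i).card (B i).card
        (σ + 1 / (((A i).card + (B i).card).choose (A i).card : ℝ)) := by
    intro i σ h
    refine h.add_pair (f := P (A i)) (hPhom (B i)) ⟨i, le_rfl, rfl⟩ ?_ ?_ fun C hC => ?_
    · rintro _ ⟨j, hj, rfl⟩
      exact ⟨j, hj.le, rfl⟩
    · rintro _ ⟨j, hj, rfl⟩
      exact hPsq _ _ (hskew i j hj)
    · have hd : Disjoint (A i) (B i) := Finset.disjoint_iff_inter_eq_empty.2 (hdisj i)
      simp only [P]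
      rw [← Finset.prod_union hd]
      exact hgen _ _ (by rw [Finset.card_union_of_disjoint hd, hC])
  have main : ∀ (k : ℕ) (hk : k < m), HasDensity {p | ∃ j, ⟨k, hk⟩ < j ∧ p = P (B j)}
      (A ⟨k, hk⟩).card (B ⟨k, hk⟩).card
      (∑ i ∈ Finset.Iic (⟨k, hk⟩ : Fin m),
        1 / (((A i).card + (B i).card).choose (A i).card : ℝ)) := by
    intro k
    induction k with
    | zero =>
      intro hk
      have hI : Finset.Iic (⟨0, hk⟩ : Fin m) = {⟨0, hk⟩} := by
        ext i; simp [Fin.le_def, Fin.ext_iff]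
      have := hadd ⟨0, hk⟩ 0 (hasDensity_zero _ (hN _))
      rwa [hI, Finset.sum_singleton, ← zero_add (1 / _)]
    | succ k ih =>
      intro hk
      have hlt : (⟨k, by omega⟩ : Fin m) < ⟨k + 1, hk⟩ := by simp [Fin.lt_def]
      have hI : Finset.Iic (⟨k + 1, hk⟩ : Fin m) =
          insert ⟨k + 1, hk⟩ (Finset.Iic (⟨k, by omega⟩ : Fin m)) := by
        ext i; simp [Fin.le_def, Fin.ext_iff]; omega
      rw [hI, Finset.sum_insert (by simp), add_comm (1 / _ : ℝ)]
      refine hadd _ _ (((ih (by omega)).change (hAmono _ _ hlt.le) (hBanti _ _ hlt.le)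
        (hN _)).mono ?_)
      rintro _ ⟨j, hj, rfl⟩
      exact ⟨j, hlt.trans_le hj, rfl⟩
  rcases m with - | m
  · simp
  · have h := (main m (Nat.lt_succ_self m)).le_one
    have hI : Finset.Iic (⟨m, Nat.lt_succ_self m⟩ : Fin (m + 1)) = Finset.univ := by
      ext i; have := i.2; simp [Fin.le_def]; omega
    rwa [hI] at h
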